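/- All graphs are finite and simple. A proper edge coloring of a graph $G$ assigns colors to the edges of $G$ so that any two distinct edges with a common endpoint get different colors; it is called acyclic if $G$ has no cycle whose edges use only two colors, and $a'(G)$ denotes the minimum number of colors in an acyclic edge coloring of $G$. Theorem. Let $G$ be a connected graph with $n$ vertices, at most $2n-1$ edges and maximum degree $\Delta \le 4$. Then $G$ has an acyclic edge coloring with $6$ colors, that is, $a'(G) \le 6$. In particular, if $\Delta = 4$, then $a'(G) \le \Delta + 2$, the bound conjectured by Alon, Sudakov and Zaks. -/

import Mathlib

namespace SimpleGraph

variable {V : Type*} {G : SimpleGraph V} {K : Type*}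

/-- An edge labeling is a proper edge coloring if any two adjacent edges (two distinct edges
with a common endpoint) receive different colors. -/
def EdgeLabeling.IsProper (c : G.EdgeLabeling K) : Prop :=
  ∀ e f : G.edgeSet, G.lineGraph.Adj e f → c e ≠ c f

/-- An acyclic edge coloring: a proper edge coloring with no bichromatic cycle, that is, for
any two colors the graph formed by the edges of these two colors contains no cycle. -/
def EdgeLabeling.IsAcyclicColoring (c : G.EdgeLabeling K) : Prop :=
  c.IsProper ∧ ∀ a b : K, (c.labelGraph a ⊔ c.labelGraph b).IsAcyclic

/-- `G` has an acyclic edge coloring with colors from a set of `k` colors. -/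
def AcyclicEdgeColorable (G : SimpleGraph V) (k : ℕ) : Prop :=
  ∃ c : G.EdgeLabeling (Fin k), c.IsAcyclicColoring

/-- The acyclic chromatic index `a'(G)`: the least number of colors of an acyclic edge coloring
(and `⊤` if no finite number of colors suffices). -/
noncomputable def acyclicChromaticIndex (G : SimpleGraph V) : ℕ∞ :=
  ⨅ k ∈ {k : ℕ | G.AcyclicEdgeColorable k}, (k : ℕ∞)

end SimpleGraph

/-!
The graph is rebuilt vertex by vertex. Connectivity and the bound on the number of edges say that
every nonempty vertex set `S` contains a vertex `x` with at most three neighbors in `S`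
(`Connected.exists_card_filter_adj_le_three`): if `S` is everything, the degrees sum to less than
`4n`; otherwise some vertex of `S` has a neighbor outside `S`. So it suffices to extend an acyclic
coloring of a graph `H` by a vertex `x` with at most three neighbors `y₁, y₂, y₃`, each of degree
at most three in `H`, after possibly recoloring `H`.

Let `Lᵢ` be the set of colors missing at `yᵢ`; it has at least three of the six colors. Colors
`aᵢ ∈ Lᵢ` for the edges `xyᵢ` are admissible when they are distinct and no `aᵢ`-`aⱼ` path joins
`yᵢ` to `yⱼ`. No such path exists if both colors are missing at one of its ends, and therefore a
choice exists as soon as the three lists pairwise intersect (`extendable_of_pairwise_inter`).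

Otherwise `L₁` and `L₂`, say, are complementary sets of three colors. If no choice is admissible,
then for two colors `p, q ∈ L₁` and every `α ∈ L₂` there are a `p`-`α` path and a `q`-`α` path
from `y₂` to `y₁` or `y₃`. Hence the neighbors `t`, `t'` of `y₂` along the colors `p` and `q` see,
besides that color, all of `L₂` and nothing else, as the degrees are at most four. Exchanging the
colors of `y₂t` and `y₂t'` then keeps the coloring acyclic (`IsAcyclicDecomposition.exchange`), and
it cuts the `p`-`α` path that ended at `y₂` (`IsAcyclicDecomposition.not_reachable_exchange`),
because a component of a union of two matchings has at most two vertices that miss one of the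
matchings (`eq_of_reachable_of_leaves`). This frees an admissible choice. The list `L₃` may
meet both `L₁` and `L₂` (`exists_extendable_of_mixed`) or coincide with one of them
(`exists_extendable_of_eq`); in the second case one further uses that an `s`-`α` path from `y₂`
cannot end both at `y₁` and at `y₃`.
-/

namespace SimpleGraph

open Finset

variable {V : Type*} {K : Type*}

/-! ### Reachability, adding edges, and unions of two matchings -/

theorem mem_of_reachable_of_closed {M : SimpleGraph V} {S : Set V} {u v : V}
    (h : M.Reachable u v) (hu : u ∈ S) (hS : ∀ x ∈ S, ∀ z, M.Adj x z → z ∈ S) : v ∈ S := by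
  obtain ⟨p⟩ := h
  induction p with
  | nil => exact hu
  | cons hadj _ ih => exact ih (hS _ hu _ hadj)

theorem not_reachable_of_isolated {M : SimpleGraph V} {u v : V} (huv : u ≠ v)
    (hv : ∀ w, ¬M.Adj v w) : ¬M.Reachable u v := fun h ↦
  huv (mem_of_reachable_of_closed (S := {v}) h.symm rfl fun _ hx z hz ↦
    absurd (hx ▸ hz) (hv z))

theorem IsAcyclic.sup_edge_of_isolated {M : SimpleGraph V} (hM : M.IsAcyclic) {x y : V}
    (hx : ∀ w, ¬M.Adj x w) : (M ⊔ edge x y).IsAcyclic := by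
  by_cases hxy : x = y
  · subst hxy
    refine hM.anti (sup_le le_rfl ?_)
    intro u v h
    grind
  · exact hM.sup_edge_of_not_reachable fun h ↦ not_reachable_of_isolated (Ne.symm hxy) hx h.symm

theorem IsAcyclic.sup_edge_sup_edge_of_isolated {M : SimpleGraph V} (hM : M.IsAcyclic) {x y z : V}
    (hx : ∀ w, ¬M.Adj x w) (hxz : x ≠ z) (hyz : ¬M.Reachable y z) :
    (M ⊔ edge x y ⊔ edge x z).IsAcyclic := by
  refine (hM.sup_edge_of_isolated hx).sup_edge_of_not_reachable fun h ↦ ?_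
  have hz : z ∈ {v | v = x ∨ M.Reachable y v} := by
    refine mem_of_reachable_of_closed h (Or.inl rfl) ?_
    rintro v hv w (hw | hw)
    · rcases hv with rfl | hv
      · exact absurd hw (hx w)
      · exact Or.inr (hv.trans hw.reachable)
    · rw [edge_adj] at hw
      rcases hw.1 with ⟨-, rfl⟩ | ⟨-, rfl⟩
      · exact Or.inr (Reachable.refl _)
      · exact Or.inl rfl
  rcases hz with hz | hz
  · exact hxz hz.symm
  · exact hyz hz

/-- A component of the union of two matchings is a path or a cycle, so it contains at most two
vertices that miss one of the matchings. -/
theorem eq_of_reachable_of_leaves {M₁ M₂ : SimpleGraph V}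
    (h₁ : ∀ u v w, M₁.Adj u v → M₁.Adj u w → v = w)
    (h₂ : ∀ u v w, M₂.Adj u v → M₂.Adj u w → v = w) {u v w : V}
    (hu : (∀ z, ¬M₁.Adj u z) ∨ ∀ z, ¬M₂.Adj u z) (hv : (∀ z, ¬M₁.Adj v z) ∨ ∀ z, ¬M₂.Adj v z)
    (hw : (∀ z, ¬M₁.Adj w z) ∨ ∀ z, ¬M₂.Adj w z) (huv : u ≠ v) (huw : u ≠ w)
    (hv' : (M₁ ⊔ M₂).Reachable u v) (hw' : (M₁ ⊔ M₂).Reachable u w) : v = w := by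
  obtain ⟨p, hp⟩ := hv'.exists_isPath
  have leaf : ∀ x, ((∀ z, ¬M₁.Adj x z) ∨ ∀ z, ¬M₂.Adj x z) →
      ∀ z z', (M₁ ⊔ M₂).Adj x z → (M₁ ⊔ M₂).Adj x z' → z = z' := by
    intro x hx z z' hz hz'
    rw [sup_adj] at hz hz'
    grind
  have nxt : ∀ i < p.length, (M₁ ⊔ M₂).Adj (p.getVert i) (p.getVert (i + 1)) :=
    fun i hi ↦ p.adj_getVert_succ hi
  have inj : ∀ i j, i ≤ p.length → j ≤ p.length → p.getVert i = p.getVert j → i = j :=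
    fun i j hi hj h ↦ hp.getVert_injOn hi hj h
  have hlen : 0 < p.length := by
    rcases Nat.eq_zero_or_pos p.length with h | h
    · exact absurd (Walk.eq_of_length_eq_zero h) huv
    · exact h
  have hinner : ∀ i, 0 < i → i < p.length → ∀ z, (M₁ ⊔ M₂).Adj (p.getVert i) z →
      z = p.getVert (i - 1) ∨ z = p.getVert (i + 1) := by
    intro i h0 hi z hz
    have a := (nxt (i - 1) (by omega)).symm
    have b := nxt i hi
    rw [Nat.sub_add_cancel h0] at a
    have hne : p.getVert (i - 1) ≠ p.getVert (i + 1) := fun h ↦ by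
      have := inj _ _ (by omega) (by omega) h
      omega
    rw [sup_adj] at a b hz
    grind
  -- The vertices of the path `p` form a whole component.
  have hwS : w ∈ {x | ∃ i ≤ p.length, p.getVert i = x} := by
    refine mem_of_reachable_of_closed hw' ⟨0, by omega, p.getVert_zero⟩ ?_
    rintro x ⟨i, hi, rfl⟩ z hz
    rcases Nat.eq_zero_or_pos i with rfl | h0
    · refine ⟨1, hlen, leaf u hu _ _ ?_ ?_⟩
      · simpa using nxt 0 hlen
      · simpa using hz
    · rcases hi.eq_or_lt with rfl | hi
      · refine ⟨p.length - 1, by omega, leaf v hv _ _ ?_ ?_⟩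
        · have := (nxt (p.length - 1) (by omega)).symm
          rw [Nat.sub_add_cancel h0] at this
          simpa using this
        · simpa using hz
      · rcases hinner i h0 hi z hz with rfl | rfl
        · exact ⟨i - 1, by omega, rfl⟩
        · exact ⟨i + 1, by omega, rfl⟩
  obtain ⟨i, hi, rfl⟩ := hwS
  rcases Nat.eq_zero_or_pos i with rfl | h0
  · simp at huw
  rcases hi.eq_or_lt with rfl | hi
  · simp
  have a := (nxt (i - 1) (by omega)).symm
  have b := nxt i hi
  rw [Nat.sub_add_cancel h0] at a
  have := inj _ _ (by omega) (by omega) (leaf _ hw _ _ a b)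
  omega

/-! ### Acyclic colorings as families of color classes -/

/-- An acyclic edge coloring of `H`, encoded by its color classes: the graphs `C a` are
edge-disjoint matchings with union `H`, and the union of any two of them has no cycle. -/
structure IsAcyclicDecomposition (H : SimpleGraph V) (C : K → SimpleGraph V) : Prop where
  eq_of_adj : ∀ a u v w, (C a).Adj u v → (C a).Adj u w → v = w
  color_unique : ∀ a b u v, (C a).Adj u v → (C b).Adj u v → a = b
  adj_iff : ∀ u v, H.Adj u v ↔ ∃ a, (C a).Adj u v
  isAcyclic : ∀ a b, (C a ⊔ C b).IsAcyclic

/-- The color `a` is missing at the vertex `v`. -/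
def IsFree (C : K → SimpleGraph V) (v : V) (a : K) : Prop := ∀ w, ¬(C a).Adj v w

namespace IsAcyclicDecomposition

variable {H : SimpleGraph V} {C : K → SimpleGraph V}

theorem exists_edgeLabeling (hC : H.IsAcyclicDecomposition C) :
    ∃ c : H.EdgeLabeling K, c.IsAcyclicColoring := by
  choose f hf using fun u v (h : H.Adj u v) ↦ (hC.adj_iff u v).1 h
  let c : H.EdgeLabeling K := EdgeLabeling.mk f fun u v h ↦
    hC.color_unique _ _ u v (hf v u h.symm).symm (hf u v h)
  have hc : ∀ u v (h : H.Adj u v), (C (c ⟨s(u, v), h⟩)).Adj u v := hf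
  have hle : ∀ a, c.labelGraph a ≤ C a := by
    intro a u v h
    obtain ⟨huv, rfl⟩ := (EdgeLabeling.labelGraph_adj u v).1 h
    exact hc u v huv
  refine ⟨c, ?_, fun a b ↦ (hC.isAcyclic a b).anti (sup_le_sup (hle a) (hle b))⟩
  intro e f hef heq
  obtain ⟨hne, v, hve, hvf⟩ := lineGraph_adj_iff_exists.1 hef
  obtain ⟨e, he⟩ := e
  obtain ⟨f, hf⟩ := f
  obtain ⟨u, rfl⟩ := Sym2.mem_iff_exists.1 hve
  obtain ⟨w, rfl⟩ := Sym2.mem_iff_exists.1 hvf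
  have huw := hC.eq_of_adj _ v u w (hc v u he) (heq ▸ hc v w hf)
  subst huw
  exact hne rfl

/-- A path in the colors `a`, `b` that ends at `v`, where `b` is missing, arrives along an edge
`vt` of color `a`; if `a` is missing at its other end, then the path does not stop at `t`. -/
theorem exists_adj_adj_of_reachable (hC : H.IsAcyclicDecomposition C) {u v : V} {a b : K}
    (huv : u ≠ v) (hu : IsFree C u a) (hv : IsFree C v b) (h : (C a ⊔ C b).Reachable u v) :
    ∃ t w, (C a).Adj v t ∧ (C b).Adj t w := by
  obtain ⟨p, hp⟩ := h.symm.exists_isPath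
  cases p with
  | nil => exact absurd rfl huv
  | cons h₁ p =>
    rcases h₁ with h₁ | h₁
    swap
    · exact absurd h₁ (hv _)
    cases p with
    | nil => exact absurd h₁.symm (hu _)
    | cons h₂ p =>
      rcases h₂ with h₂ | h₂
      · have := hC.eq_of_adj _ _ _ _ h₁.symm h₂
        subst this
        simp [Walk.cons_isPath_iff] at hp
      · exact ⟨_, _, h₁, h₂⟩

theorem card_le_card_add_card_free [Fintype K] (hC : H.IsAcyclicDecomposition C) (v : V)
    (s : Finset V) (hs : ∀ w, H.Adj v w → w ∈ s) [DecidablePred (IsFree C v)] :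
    Fintype.card K ≤ #s + #{a | IsFree C v a} := by
  classical
  rw [← Finset.card_univ, ← Finset.card_filter_add_card_filter_not (IsFree C v), add_comm]
  refine Nat.add_le_add_right ?_ _
  have h : ∀ a, ¬IsFree C v a → ∃ w, (C a).Adj v w := fun a ha ↦ by
    simpa [IsFree] using ha
  have : Nonempty V := ⟨v⟩
  choose! g hg using h
  refine Finset.card_le_card_of_injOn g ?_ ?_
  · intro a ha
    exact hs _ ((hC.adj_iff _ _).2 ⟨a, hg a (by simpa using ha)⟩)
  · intro a ha b hb hab
    have ha' := hg a (by simpa using ha)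
    have hb' := hg b (by simpa using hb)
    rw [← hab] at hb'
    exact hC.color_unique _ _ _ _ ha' hb'

end IsAcyclicDecomposition

/-! ### Adding a vertex -/

section AddVertex

/-- The color classes after joining `x` to each vertex `v` of `N` by an edge of color `f v`. -/
def addVertex (C : K → SimpleGraph V) (x : V) (N : Set V) (f : V → K) (a : K) : SimpleGraph V :=
  C a ⊔ fromRel fun u v ↦ u = x ∧ v ∈ N ∧ f v = a

theorem addVertex_adj {C : K → SimpleGraph V} {x : V} {N : Set V} (hxN : x ∉ N) {f : V → K} {a : K}
    {u v : V} : (addVertex C x N f a).Adj u v ↔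
      (C a).Adj u v ∨ (u = x ∧ v ∈ N ∧ f v = a) ∨ (v = x ∧ u ∈ N ∧ f u = a) := by
  simp only [addVertex, sup_adj, fromRel_adj]
  grind

theorem IsAcyclicDecomposition.addVertex {H H' : SimpleGraph V} {C : K → SimpleGraph V}
    (hC : H.IsAcyclicDecomposition C) {x : V} (hx : ∀ w, ¬H.Adj x w) {N : Set V} (hxN : x ∉ N)
    {f : V → K} (hH' : ∀ u v, H'.Adj u v ↔ H.Adj u v ∨ (u = x ∧ v ∈ N) ∨ (v = x ∧ u ∈ N))
    (hf : N.InjOn f) (hfree : ∀ y ∈ N, IsFree C y (f y))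
    (hreach : ∀ y ∈ N, ∀ z ∈ N, y ≠ z → ¬(C (f y) ⊔ C (f z)).Reachable y z) :
    H'.IsAcyclicDecomposition (addVertex C x N f) := by
  have hxC : ∀ a w, ¬(C a).Adj x w := fun a w h ↦ hx w ((hC.adj_iff _ _).2 ⟨a, h⟩)
  have hxC' : ∀ a w, ¬(C a).Adj w x := fun a w h ↦ hxC a w h.symm
  refine ⟨?_, ?_, ?_, ?_⟩
  · intro a u v w hv hw
    rw [addVertex_adj hxN] at hv hw
    have h1 := hC.eq_of_adj a u v w
    have h2 : ∀ y ∈ N, f y = a → ∀ w, ¬(C a).Adj y w := fun y hy h ↦ h ▸ hfree y hy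
    have h3 : ∀ y ∈ N, ∀ z ∈ N, f y = f z → y = z := fun y hy z hz h ↦ hf hy hz h
    grind
  · intro a b u v hv hw
    rw [addVertex_adj hxN] at hv hw
    have h1 := hC.color_unique a b u v
    grind
  · intro u v
    simp only [addVertex_adj hxN, hH', hC.adj_iff]
    grind
  · intro a b
    have hM : ∀ w, ¬(C a ⊔ C b).Adj x w := fun w h ↦ h.elim (hxC a w) (hxC b w)
    have hac := hC.isAcyclic a b
    -- A color class contains at most one edge at `x`.
    have key : ∀ c, (∀ z ∈ N, f z ≠ c) ∨ ∃ y ∈ N, f y = c ∧ ∀ z ∈ N, f z = c → z = y := by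
      intro c
      by_cases h : ∃ y ∈ N, f y = c
      · obtain ⟨y, hy, rfl⟩ := h
        exact Or.inr ⟨y, hy, rfl, fun z hz h ↦ hf hz hy h⟩
      · push Not at h
        exact Or.inl h
    rcases key a with ha | ⟨y, hy, rfl, ha⟩ <;> rcases key b with hb | ⟨z, hz, rfl, hb⟩
    · refine hac.anti ?_
      intro u v h
      simp only [sup_adj, addVertex_adj hxN] at h ⊢
      grind
    · refine (hac.sup_edge_of_isolated (y := z) hM).anti ?_
      intro u v h
      simp only [sup_adj, addVertex_adj hxN, edge_adj] at h ⊢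
      grind
    · refine (hac.sup_edge_of_isolated (y := y) hM).anti ?_
      intro u v h
      simp only [sup_adj, addVertex_adj hxN, edge_adj] at h ⊢
      grind
    · by_cases hyz : y = z
      · subst hyz
        refine (hac.sup_edge_of_isolated (y := y) hM).anti ?_
        intro u v h
        simp only [sup_adj, addVertex_adj hxN, edge_adj] at h ⊢
        grind
      · refine (hac.sup_edge_sup_edge_of_isolated hM (z := z) (by grind)
          (hreach y hy z hz hyz)).anti ?_
        intro u v h
        simp only [sup_adj, addVertex_adj hxN, edge_adj] at h ⊢
        grind

end AddVertex

/-! ### Exchanging the colors of two edges at a vertex -/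

section Exchange

variable {H : SimpleGraph V} {C : K → SimpleGraph V} {y t t' : V} {p q : K}

open Classical in
/-- The color classes after exchanging the colors of the edges `yt` and `yt'`, which are meant to
have the colors `p` and `q`. -/
noncomputable def exchange (C : K → SimpleGraph V) (y t t' : V) (p q : K) (c : K) : SimpleGraph V :=
  if c = p then C p \ edge y t ⊔ edge y t' else if c = q then C q \ edge y t' ⊔ edge y t else C c

@[simp] theorem exchange_left : exchange C y t t' p q p = C p \ edge y t ⊔ edge y t' := by
  simp [exchange]

theorem exchange_right (hpq : p ≠ q) : exchange C y t t' p q q = C q \ edge y t' ⊔ edge y t := by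
  simp [exchange, hpq.symm]

theorem exchange_of_ne {c : K} (hp : c ≠ p) (hq : c ≠ q) : exchange C y t t' p q c = C c := by
  simp [exchange, hp, hq]

/-- After `yt` is removed from the color `p`, one of `y`, `t'` is isolated in the union of the
colors `p` and `b`, so adding `yt'` closes no cycle. -/
theorem IsAcyclicDecomposition.isAcyclic_exchange_left (hC : H.IsAcyclicDecomposition C)
    (hp : (C p).Adj y t) (hq : (C q).Adj y t') (hp' : IsFree C t' p) {b : K}
    (hb : IsFree C y b ∨ IsFree C t' b) : (C p \ edge y t ⊔ edge y t' ⊔ C b).IsAcyclic := by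
  have hM : (C p \ edge y t ⊔ C b).IsAcyclic :=
    (hC.isAcyclic p b).anti (sup_le_sup sdiff_le le_rfl)
  have hiso : ¬(C p \ edge y t ⊔ C b).Reachable y t' := by
    rcases hb with hb | hb
    · refine fun h ↦ not_reachable_of_isolated hq.ne' (fun w hw ↦ ?_) h.symm
      rcases hw with hw | hw
      · rw [sdiff_adj, edge_adj] at hw
        have := hC.eq_of_adj _ _ _ _ hp hw.1
        have := hp.ne
        grind
      · exact hb _ hw
    · refine not_reachable_of_isolated hq.ne fun w hw ↦ ?_
      rcases hw with hw | hw
      · exact hp' _ ((sdiff_adj ..).1 hw).1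
      · exact hb _ hw
  refine (hM.sup_edge_of_not_reachable hiso).anti (le_of_eq ?_)
  rw [sup_right_comm]

theorem IsAcyclicDecomposition.exchange (hC : H.IsAcyclicDecomposition C) (hpq : p ≠ q)
    (hp : (C p).Adj y t) (hq : (C q).Adj y t') (ht : IsFree C t q) (ht' : IsFree C t' p)
    (hb : ∀ b, b ≠ p → b ≠ q → IsFree C y b ∨ IsFree C t b ∧ IsFree C t' b) :
    H.IsAcyclicDecomposition (exchange C y t t' p q) := by
  have hpp := hC.eq_of_adj p
  have hqq := hC.eq_of_adj q
  have hu := hC.color_unique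
  have hs : ∀ c u v, (C c).Adj u v → (C c).Adj v u := fun c u v h ↦ h.symm
  have hne := hp.ne
  have hne' := hq.ne
  have htt : t ≠ t' := fun h ↦ ht' y (h ▸ hp.symm)
  simp only [IsFree] at ht ht'
  have adj_p : ∀ u v, (SimpleGraph.exchange C y t t' p q p).Adj u v ↔
      (C p).Adj u v ∧ ¬(u = y ∧ v = t ∨ u = t ∧ v = y) ∨ (u = y ∧ v = t' ∨ u = t' ∧ v = y) := by
    intro u v
    rw [exchange_left, sup_adj, sdiff_adj, edge_adj, edge_adj]
    grind
  have adj_q : ∀ u v, (SimpleGraph.exchange C y t t' p q q).Adj u v ↔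
      (C q).Adj u v ∧ ¬(u = y ∧ v = t' ∨ u = t' ∧ v = y) ∨ (u = y ∧ v = t ∨ u = t ∧ v = y) := by
    intro u v
    rw [exchange_right hpq, sup_adj, sdiff_adj, edge_adj, edge_adj]
    grind
  have hcase : ∀ c, c = p ∨ c = q ∨ c ≠ p ∧ c ≠ q := fun c ↦ by grind
  refine ⟨?_, ?_, ?_, ?_⟩
  · intro a u v w hv hw
    rcases hcase a with rfl | rfl | ⟨h1, h2⟩
    · rw [adj_p] at hv hw
      grind
    · rw [adj_q] at hv hw
      grind
    · rw [exchange_of_ne h1 h2] at hv hw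
      exact hC.eq_of_adj _ _ _ _ hv hw
  · intro a b u v hv hw
    -- Only the two exchanged edges have a new color.
    have main : ∀ c, (SimpleGraph.exchange C y t t' p q c).Adj u v →
        (C c).Adj u v ∧ ¬(s(u, v) = s(y, t) ∨ s(u, v) = s(y, t')) ∨
        c = p ∧ s(u, v) = s(y, t') ∨ c = q ∧ s(u, v) = s(y, t) := by
      intro c h
      simp only [Sym2.eq_iff]
      rcases hcase c with rfl | rfl | ⟨h1, h2⟩
      · rw [adj_p] at h
        grind
      · rw [adj_q] at h
        grind
      · rw [exchange_of_ne h1 h2] at h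
        grind
    have htt' : s(y, t) ≠ s(y, t') := by
      simp only [ne_eq, Sym2.eq_iff]
      grind
    have := main a hv
    have := main b hw
    have := hu a b u v
    grind
  · intro u v
    rw [hC.adj_iff]
    constructor
    · rintro ⟨c, h⟩
      by_cases h1 : s(u, v) = s(y, t)
      · refine ⟨q, ?_⟩
        rw [adj_q]
        simp only [Sym2.eq_iff] at h1
        grind
      by_cases h2 : s(u, v) = s(y, t')
      · refine ⟨p, ?_⟩
        rw [adj_p]
        simp only [Sym2.eq_iff] at h2
        grind
      refine ⟨c, ?_⟩
      simp only [Sym2.eq_iff] at h1 h2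
      rcases hcase c with rfl | rfl | ⟨h3, h4⟩
      · rw [adj_p]; grind
      · rw [adj_q]; grind
      · rwa [exchange_of_ne h3 h4]
    · rintro ⟨c, h⟩
      rcases hcase c with rfl | rfl | ⟨h3, h4⟩
      · rw [adj_p] at h; grind
      · rw [adj_q] at h; grind
      · rw [exchange_of_ne h3 h4] at h; exact ⟨c, h⟩
  · have hP : ∀ b, b ≠ p → b ≠ q →
        (SimpleGraph.exchange C y t t' p q p ⊔ SimpleGraph.exchange C y t t' p q b).IsAcyclic := by
      intro b h1 h2
      rw [exchange_left, exchange_of_ne h1 h2]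
      exact hC.isAcyclic_exchange_left hp hq ht' ((hb b h1 h2).imp_right And.right)
    have hQ : ∀ b, b ≠ p → b ≠ q →
        (SimpleGraph.exchange C y t t' p q q ⊔ SimpleGraph.exchange C y t t' p q b).IsAcyclic := by
      intro b h1 h2
      rw [exchange_right hpq, exchange_of_ne h1 h2]
      exact hC.isAcyclic_exchange_left hq hp ht ((hb b h1 h2).imp_right And.left)
    have hPQ : (SimpleGraph.exchange C y t t' p q p ⊔
        SimpleGraph.exchange C y t t' p q q).IsAcyclic := by
      refine (hC.isAcyclic p q).anti ?_
      intro u v h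
      rw [sup_adj, adj_p, adj_q] at h
      rw [sup_adj]
      grind
    intro a b
    rcases hcase a with rfl | rfl | ⟨h1, h2⟩ <;> rcases hcase b with rfl | rfl | ⟨h3, h4⟩
    · exact hPQ.anti (sup_le le_sup_left le_sup_left)
    · exact hPQ
    · exact hP _ h3 h4
    · rw [sup_comm]; exact hPQ
    · exact hPQ.anti (sup_le le_sup_right le_sup_right)
    · exact hQ _ h3 h4
    · rw [sup_comm]; exact hP _ h1 h2
    · rw [sup_comm]; exact hQ _ h1 h2
    · rw [exchange_of_ne h1 h2, exchange_of_ne h3 h4]; exact hC.isAcyclic a b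

theorem isFree_exchange_iff (hpq : p ≠ q) (hp : (C p).Adj y t) (hq : (C q).Adj y t')
    {v : V} (hv : v ≠ t) (hv' : v ≠ t') {a : K} :
    IsFree (exchange C y t t' p q) v a ↔ IsFree C v a := by
  by_cases hvy : v = y
  · subst hvy
    by_cases h1 : a = p
    · subst h1
      refine iff_of_false (fun h ↦ h t' ?_) fun h ↦ h _ hp
      rw [exchange_left, sup_adj, edge_adj]
      exact Or.inr ⟨Or.inl ⟨rfl, rfl⟩, hv'⟩
    by_cases h2 : a = q
    · subst h2
      refine iff_of_false (fun h ↦ h t ?_) fun h ↦ h _ hq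
      rw [exchange_right hpq, sup_adj, edge_adj]
      exact Or.inr ⟨Or.inl ⟨rfl, rfl⟩, hv⟩
    rw [IsFree, exchange_of_ne h1 h2, IsFree]
  · refine forall_congr' fun w ↦ not_congr ?_
    by_cases h1 : a = p
    · subst h1
      rw [exchange_left, sup_adj, sdiff_adj, edge_adj, edge_adj]
      grind
    by_cases h2 : a = q
    · subst h2
      rw [exchange_right hpq, sup_adj, sdiff_adj, edge_adj, edge_adj]
      grind
    rw [exchange_of_ne h1 h2]

/-- The exchange cuts a `p`-`α` path from `w` to `y` at its last edge `yt`: a new path would have to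
enter `y` through `t'`, but `t'` was not in the component of `w` and `y`, which already had these
two as its ends. -/
theorem IsAcyclicDecomposition.not_reachable_exchange (hC : H.IsAcyclicDecomposition C)
    (hp : (C p).Adj y t) (hq : (C q).Adj y t') (ht' : IsFree C t' p) {w : V} {α : K}
    (hαp : α ≠ p) (hαq : α ≠ q) (hwy : w ≠ y) (hwt : w ≠ t') (hw : IsFree C w p)
    (hy : IsFree C y α) (h : (C p ⊔ C α).Reachable w y) :
    ¬(SimpleGraph.exchange C y t t' p q p ⊔
      SimpleGraph.exchange C y t t' p q α).Reachable w y := by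
  have hyt := hq.ne
  have hnot : ¬(C p ⊔ C α).Reachable w t' := fun h' ↦
    hyt (eq_of_reachable_of_leaves (hC.eq_of_adj p) (hC.eq_of_adj α) (Or.inl hw) (Or.inr hy)
      (Or.inl ht') hwy hwt h h')
  rw [exchange_left, exchange_of_ne hαp hαq]
  intro h'
  have hmem : y ∈ {v | (C p ⊔ C α).Reachable w v ∧ v ≠ y} := by
    refine mem_of_reachable_of_closed h' ⟨Reachable.refl _, hwy⟩ ?_
    rintro v ⟨hv, hvy⟩ z hz
    have hvt : v ≠ t' := fun h ↦ hnot (h ▸ hv)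
    simp only [sup_adj, sdiff_adj, edge_adj] at hz
    have hz' : (C p ⊔ C α).Adj v z := by
      rw [sup_adj]
      grind
    refine ⟨hv.trans hz'.reachable, ?_⟩
    rintro rfl
    have h1 := hC.eq_of_adj p z v t
    have h2 : ¬(C α).Adj v z := fun h ↦ hy _ h.symm
    have h3 : (C p).Adj v z → (C p).Adj z v := fun h ↦ h.symm
    grind
  exact hmem.2 rfl

end Exchange

/-! ### Choosing colors at a new vertex without recoloring -/

section Choice

open Classical in
/-- The set of the colors, out of six, that are missing at `v`. -/
noncomputable def freeColors (C : Fin 6 → SimpleGraph V) (v : V) : Finset (Fin 6) :=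
  {a | IsFree C v a}

@[simp] theorem mem_freeColors {C : Fin 6 → SimpleGraph V} {v : V} {a : Fin 6} :
    a ∈ freeColors C v ↔ IsFree C v a := by
  simp [freeColors]

/-- There are colors `a₁, a₂, a₃` for the edges from a new vertex to `y₁, y₂, y₃` that extend
the coloring `C` to an acyclic one. -/
def Extendable (C : Fin 6 → SimpleGraph V) (y₁ y₂ y₃ : V) : Prop :=
  ∃ a₁ a₂ a₃, a₁ ≠ a₂ ∧ a₁ ≠ a₃ ∧ a₂ ≠ a₃ ∧ IsFree C y₁ a₁ ∧ IsFree C y₂ a₂ ∧ IsFree C y₃ a₃ ∧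
    ¬(C a₁ ⊔ C a₂).Reachable y₁ y₂ ∧ ¬(C a₁ ⊔ C a₃).Reachable y₁ y₃ ∧
    ¬(C a₂ ⊔ C a₃).Reachable y₂ y₃

variable {C : Fin 6 → SimpleGraph V} {y₁ y₂ y₃ : V}

theorem Extendable.swap₁₂ (h : Extendable C y₁ y₂ y₃) : Extendable C y₂ y₁ y₃ := by
  obtain ⟨a₁, a₂, a₃, h₁₂, h₁₃, h₂₃, f₁, f₂, f₃, r₁₂, r₁₃, r₂₃⟩ := h
  refine ⟨a₂, a₁, a₃, h₁₂.symm, h₂₃, h₁₃, f₂, f₁, f₃, ?_, r₂₃, r₁₃⟩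
  rwa [sup_comm, reachable_comm]

theorem Extendable.swap₂₃ (h : Extendable C y₁ y₂ y₃) : Extendable C y₁ y₃ y₂ := by
  obtain ⟨a₁, a₂, a₃, h₁₂, h₁₃, h₂₃, f₁, f₂, f₃, r₁₂, r₁₃, r₂₃⟩ := h
  refine ⟨a₁, a₃, a₂, h₁₃, h₁₂, h₂₃.symm, f₁, f₃, f₂, r₁₃, r₁₂, ?_⟩
  rwa [sup_comm, reachable_comm]

theorem not_reachable_of_isFree {u v : V} {a b : Fin 6} (huv : u ≠ v)
    (h : IsFree C u a ∧ IsFree C u b ∨ IsFree C v a ∧ IsFree C v b) :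
    ¬(C a ⊔ C b).Reachable u v := by
  rcases h with ⟨ha, hb⟩ | ⟨ha, hb⟩
  · rw [reachable_comm]
    exact not_reachable_of_isolated huv.symm fun w hw ↦ hw.elim (ha w) (hb w)
  · exact not_reachable_of_isolated huv fun w hw ↦ hw.elim (ha w) (hb w)

/-- A color `p` missing at all three vertices and another color `q` missing at `y₁` and `y₂`
suffice: use `p` at `y₃`, `q` at `y₁`, and any third color missing at `y₂` there. -/
theorem extendable_of_mem_inter (h₁₂ : y₁ ≠ y₂) (h₁₃ : y₁ ≠ y₃) (h₂₃ : y₂ ≠ y₃)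
    (hcard : 3 ≤ #(freeColors C y₂)) {p q : Fin 6} (hpq : p ≠ q)
    (hp₁ : IsFree C y₁ p) (hp₂ : IsFree C y₂ p) (hp₃ : IsFree C y₃ p)
    (hq₁ : IsFree C y₁ q) (hq₂ : IsFree C y₂ q) : Extendable C y₁ y₂ y₃ := by
  obtain ⟨r, hr, hr'⟩ : ∃ r ∈ freeColors C y₂, r ∉ ({p, q} : Finset (Fin 6)) :=
    exists_mem_notMem_of_card_lt_card (lt_of_le_of_lt card_le_two hcard)
  simp only [mem_insert, mem_singleton, not_or, mem_freeColors] at hr hr'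
  exact ⟨q, r, p, Ne.symm hr'.2, hpq.symm, hr'.1, hq₁, hr, hp₃,
    not_reachable_of_isFree h₁₂ (.inr ⟨hq₂, hr⟩),
    not_reachable_of_isFree h₁₃ (.inl ⟨hq₁, hp₁⟩),
    not_reachable_of_isFree h₂₃ (.inl ⟨hr, hp₂⟩)⟩

theorem extendable_of_pairwise_inter (h₁₂ : y₁ ≠ y₂) (h₁₃ : y₁ ≠ y₃) (h₂₃ : y₂ ≠ y₃)
    (hc₁ : 3 ≤ #(freeColors C y₁)) (hc₂ : 3 ≤ #(freeColors C y₂)) (hc₃ : 3 ≤ #(freeColors C y₃))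
    (hd₁₂ : ¬Disjoint (freeColors C y₁) (freeColors C y₂))
    (hd₁₃ : ¬Disjoint (freeColors C y₁) (freeColors C y₃))
    (hd₂₃ : ¬Disjoint (freeColors C y₂) (freeColors C y₃)) : Extendable C y₁ y₂ y₃ := by
  by_cases hp : ∃ p, IsFree C y₁ p ∧ IsFree C y₂ p ∧ IsFree C y₃ p
  · obtain ⟨p, hp₁, hp₂, hp₃⟩ := hp
    by_contra hcon
    -- The lists without `p` are disjoint sets of at least two among the five remaining colors.
    have d₁₂ : Disjoint ((freeColors C y₁).erase p) ((freeColors C y₂).erase p) := by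
      rw [Finset.disjoint_left]
      intro q h h'
      simp only [mem_erase, mem_freeColors] at h h'
      exact hcon (extendable_of_mem_inter h₁₂ h₁₃ h₂₃ hc₂ (Ne.symm h.1) hp₁ hp₂ hp₃ h.2 h'.2)
    have d₁₃ : Disjoint ((freeColors C y₁).erase p) ((freeColors C y₃).erase p) := by
      rw [Finset.disjoint_left]
      intro q h h'
      simp only [mem_erase, mem_freeColors] at h h'
      exact hcon (extendable_of_mem_inter h₁₃ h₁₂ h₂₃.symm hc₃ (Ne.symm h.1)
        hp₁ hp₃ hp₂ h.2 h'.2).swap₂₃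
    have d₂₃ : Disjoint ((freeColors C y₂).erase p) ((freeColors C y₃).erase p) := by
      rw [Finset.disjoint_left]
      intro q h h'
      simp only [mem_erase, mem_freeColors] at h h'
      exact hcon (extendable_of_mem_inter h₂₃ h₁₂.symm h₁₃.symm hc₃ (Ne.symm h.1)
        hp₂ hp₃ hp₁ h.2 h'.2).swap₂₃.swap₁₂
    have hsub : ((freeColors C y₁).erase p ∪ (freeColors C y₂).erase p ∪ (freeColors C y₃).erase p)
        ⊆ univ.erase p := by
      intro q
      simp only [mem_union, mem_erase, mem_univ, and_true]
      grind
    have := card_le_card hsub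
    rw [card_union_of_disjoint (disjoint_union_left.2 ⟨d₁₃, d₂₃⟩), card_union_of_disjoint d₁₂,
      card_erase_of_mem (mem_univ _), card_erase_of_mem (by simpa using hp₁),
      card_erase_of_mem (by simpa using hp₂), card_erase_of_mem (by simpa using hp₃),
      card_univ, Fintype.card_fin] at this
    omega
  · rw [not_disjoint_iff] at hd₁₂ hd₁₃ hd₂₃
    -- Without a common color of all three, the three pairwise common colors are distinct.
    obtain ⟨a, ha₁, ha₂⟩ := hd₁₂
    obtain ⟨b, hb₁, hb₃⟩ := hd₁₃
    obtain ⟨c, hc₂, hc₃⟩ := hd₂₃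
    rw [mem_freeColors] at *
    exact ⟨a, c, b, by grind, by grind, by grind, ha₁, hc₂, hb₃,
      not_reachable_of_isFree h₁₂ (.inr ⟨ha₂, hc₂⟩),
      not_reachable_of_isFree h₁₃ (.inl ⟨ha₁, hb₁⟩),
      not_reachable_of_isFree h₂₃ (.inr ⟨hc₃, hb₃⟩)⟩

theorem isFree_iff_not_isFree (hc₁ : 3 ≤ #(freeColors C y₁)) (hc₂ : 3 ≤ #(freeColors C y₂))
    (hd : Disjoint (freeColors C y₁) (freeColors C y₂)) (a : Fin 6) :
    IsFree C y₁ a ↔ ¬IsFree C y₂ a := by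
  have hu : freeColors C y₁ ∪ freeColors C y₂ = univ := by
    refine eq_of_subset_of_card_le (subset_univ _) ?_
    rw [card_union_of_disjoint hd, card_univ, Fintype.card_fin]
    omega
  have ha : a ∈ freeColors C y₁ ∪ freeColors C y₂ := hu ▸ mem_univ a
  rw [Finset.disjoint_left] at hd
  have := hd (a := a)
  simp only [mem_union, mem_freeColors] at *
  tauto

end Choice

/-! ### Complementary lists: recoloring before the extension -/

section Recolor

variable {H : SimpleGraph V} {C : Fin 6 → SimpleGraph V} {y₁ y₂ y₃ : V}

/-- If the neighbor `t` of `y` along the color `p` sees all colors missing at `y`, then it sees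
no others except `p`, since it has degree at most four. -/
theorem isFree_iff_of_full (hfree : ∀ v, 2 ≤ #(freeColors C v))
    {y t s : V} (hc : 3 ≤ #(freeColors C y)) {p : Fin 6} (hp : (C p).Adj y t)
    (hs : (C p).Adj t s)
    (ht : ∀ a, IsFree C y a → ¬IsFree C t a) (b : Fin 6) :
    IsFree C t b ↔ b ≠ p ∧ ¬IsFree C y b := by
  have hpy : p ∉ freeColors C y := fun h ↦ mem_freeColors.1 h _ hp
  have hsub : freeColors C t ⊆ univ \ insert p (freeColors C y) := by
    intro a ha
    rw [mem_freeColors] at ha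
    simp only [mem_sdiff, mem_univ, mem_insert, mem_freeColors, true_and]
    rintro (rfl | h)
    · exact ha _ hs
    · exact ht _ h ha
  have heq := eq_of_subset_of_card_le hsub (by
    rw [card_sdiff_of_subset (subset_univ _), card_insert_of_notMem hpy, card_univ,
      Fintype.card_fin]
    have := hfree t
    omega)
  rw [← mem_freeColors, heq]
  simp [not_or]

/-- If the neighbors of `y` along `p` and `q` see all colors missing at `y`, these two colors can be
exchanged at `y`. This does not affect the colors missing at vertices of degree at most three, and
cuts every path in the colors `p` and `α` that joins such a vertex, missing `p`, to `y`. -/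
theorem IsAcyclicDecomposition.exists_exchange (hC : H.IsAcyclicDecomposition C)
    (hfree : ∀ v, 2 ≤ #(freeColors C v)) {y : V} (hc : 3 ≤ #(freeColors C y)) {p q : Fin 6}
    (hpq : p ≠ q) (hp : ¬IsFree C y p) (hq : ¬IsFree C y q)
    (hpt : ∀ α, IsFree C y α → ∃ t w, (C p).Adj y t ∧ (C α).Adj t w)
    (hqt : ∀ α, IsFree C y α → ∃ t w, (C q).Adj y t ∧ (C α).Adj t w) :
    ∃ C' : Fin 6 → SimpleGraph V, H.IsAcyclicDecomposition C' ∧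
      (∀ c, c ≠ p → c ≠ q → C' c = C c) ∧
      (∀ v, 3 ≤ #(freeColors C v) → ∀ a, IsFree C' v a ↔ IsFree C v a) ∧
      ∀ w α, w ≠ y → 3 ≤ #(freeColors C w) → IsFree C w p → IsFree C y α →
        (C p ⊔ C α).Reachable w y → ¬(C' p ⊔ C' α).Reachable w y := by
  have hp₀ := hp
  have hq₀ := hq
  simp only [IsFree, not_forall, not_not] at hp hq
  obtain ⟨t, ht⟩ := hp
  obtain ⟨t', ht'⟩ := hq
  have full : ∀ α, IsFree C y α → ¬IsFree C t α := by
    intro α hα h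
    obtain ⟨s, w, h₁, h₂⟩ := hpt α hα
    exact h w (hC.eq_of_adj _ _ _ _ h₁ ht ▸ h₂)
  have full' : ∀ α, IsFree C y α → ¬IsFree C t' α := by
    intro α hα h
    obtain ⟨s, w, h₁, h₂⟩ := hqt α hα
    exact h w (hC.eq_of_adj _ _ _ _ h₁ ht' ▸ h₂)
  have free := isFree_iff_of_full hfree hc ht ht.symm full
  have free' := isFree_iff_of_full hfree hc ht' ht'.symm full'
  -- A vertex with three free colors is neither `t` nor `t'`, which have only two.
  have ne : ∀ v, 3 ≤ #(freeColors C v) → v ≠ t ∧ v ≠ t' := by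
    have key : ∀ (r : Fin 6) (s : V), (∀ b, IsFree C s b ↔ b ≠ r ∧ ¬IsFree C y b) →
        ¬IsFree C y r → ¬3 ≤ #(freeColors C s) := by
      intro r s hs hr hcard
      have hr' : r ∉ freeColors C s := fun h ↦ ((hs r).1 (mem_freeColors.1 h)).1 rfl
      have hd : Disjoint (insert r (freeColors C s)) (freeColors C y) := by
        rw [Finset.disjoint_left]
        intro a ha ha'
        simp only [mem_insert, mem_freeColors] at ha ha'
        rcases ha with rfl | ha
        · exact hr ha'
        · exact ((hs a).1 ha).2 ha'
      have := card_le_univ (insert r (freeColors C s) ∪ freeColors C y)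
      rw [card_union_of_disjoint hd, card_insert_of_notMem hr', Fintype.card_fin] at this
      omega
    rintro v hv
    exact ⟨fun h ↦ key p t free hp₀ (h ▸ hv), fun h ↦ key q t' free' hq₀ (h ▸ hv)⟩
  refine ⟨_, hC.exchange hpq ht ht' ((free q).2 ⟨hpq.symm, hq₀⟩) ((free' p).2 ⟨hpq, hp₀⟩) ?_,
    fun c h₁ h₂ ↦ exchange_of_ne h₁ h₂, ?_, ?_⟩
  · intro b h₁ h₂
    rw [free, free']
    tauto
  · intro v hv a
    exact isFree_exchange_iff hpq ht ht' (ne v hv).1 (ne v hv).2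
  · intro w α hwy hw hwp hα hr
    refine hC.not_reachable_exchange ht ht' ((free' p).2 ⟨hpq, hp₀⟩) ?_ ?_ hwy (ne w hw).2 hwp hα hr
    · rintro rfl; exact hp₀ hα
    · rintro rfl; exact hq₀ hα

/-- The lists of `y₁` and `y₂` are complementary, and the list of `y₃` meets both. -/
theorem IsAcyclicDecomposition.exists_extendable_of_mixed (hC : H.IsAcyclicDecomposition C)
    (hfree : ∀ v, 2 ≤ #(freeColors C v)) (h₁₂ : y₁ ≠ y₂) (h₁₃ : y₁ ≠ y₃) (h₂₃ : y₂ ≠ y₃)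
    (hc₁ : 3 ≤ #(freeColors C y₁)) (hc₂ : 3 ≤ #(freeColors C y₂)) (hc₃ : 3 ≤ #(freeColors C y₃))
    (hcompl : ∀ a, IsFree C y₁ a ↔ ¬IsFree C y₂ a) {p q r : Fin 6} (hpq : p ≠ q)
    (hp₁ : IsFree C y₁ p) (hq₁ : IsFree C y₁ q) (hp₃ : IsFree C y₃ p) (hq₃ : IsFree C y₃ q)
    (hr₂ : IsFree C y₂ r) (hr₃ : IsFree C y₃ r) :
    ∃ C' : Fin 6 → SimpleGraph V, H.IsAcyclicDecomposition C' ∧ Extendable C' y₁ y₂ y₃ := by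
  by_contra! hcon
  -- Give the color `p` to `y₁`, `α` to `y₂`, and `r` (or `q`, if `α = r`) to `y₃`: only the pair
  -- `y₁`, `y₂` can be in conflict.
  have step : ∀ p q, p ≠ q → IsFree C y₁ p → IsFree C y₁ q → IsFree C y₃ p → IsFree C y₃ q →
      ∀ α, IsFree C y₂ α → (C p ⊔ C α).Reachable y₁ y₂ := by
    intro p q hpq hp₁ hq₁ hp₃ hq₃ α hα
    by_contra h
    have hpα : p ≠ α := fun h ↦ (hcompl p).1 hp₁ (h ▸ hα)
    have hqα : q ≠ α := fun h ↦ (hcompl q).1 hq₁ (h ▸ hα)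
    have hpr : p ≠ r := fun h ↦ (hcompl p).1 hp₁ (h ▸ hr₂)
    by_cases hαr : α = r
    · subst hαr
      exact hcon C hC ⟨p, α, q, hpα, hpq, hqα.symm, hp₁, hα, hq₃, h,
        not_reachable_of_isFree h₁₃ (.inl ⟨hp₁, hq₁⟩),
        not_reachable_of_isFree h₂₃ (.inr ⟨hr₃, hq₃⟩)⟩
    · exact hcon C hC ⟨p, α, r, hpα, hpr, hαr, hp₁, hα, hr₃, h,
        not_reachable_of_isFree h₁₃ (.inr ⟨hp₃, hr₃⟩),
        not_reachable_of_isFree h₂₃ (.inl ⟨hα, hr₂⟩)⟩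
  have hp := step p q hpq hp₁ hq₁ hp₃ hq₃
  have hq := step q p hpq.symm hq₁ hp₁ hq₃ hp₃
  obtain ⟨C', hC', -, hfr, hreach⟩ := hC.exists_exchange hfree hc₂ hpq ((hcompl p).1 hp₁)
    ((hcompl q).1 hq₁)
    (fun α hα ↦ hC.exists_adj_adj_of_reachable h₁₂ hp₁ hα (hp α hα))
    (fun α hα ↦ hC.exists_adj_adj_of_reachable h₁₂ hq₁ hα (hq α hα))
  have hpr : p ≠ r := fun h ↦ (hcompl p).1 hp₁ (h ▸ hr₂)
  have hqr : q ≠ r := fun h ↦ (hcompl q).1 hq₁ (h ▸ hr₂)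
  have f₁ := hfr y₁ hc₁
  have f₂ := hfr y₂ hc₂
  have f₃ := hfr y₃ hc₃
  exact hcon C' hC' ⟨p, r, q, hpr, hpq, hqr.symm, (f₁ p).2 hp₁, (f₂ r).2 hr₂, (f₃ q).2 hq₃,
    hreach y₁ r h₁₂ hc₁ hp₁ hr₂ (hp r hr₂),
    not_reachable_of_isFree h₁₃ (.inl ⟨(f₁ p).2 hp₁, (f₁ q).2 hq₁⟩),
    not_reachable_of_isFree h₂₃ (.inr ⟨(f₃ r).2 hr₃, (f₃ q).2 hq₃⟩)⟩

/-- The step of `exists_extendable_of_eq` in which the exchange takes place: the `s`-`α` path from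
`y₂` ends at `y₁`, so `s` is available for `y₃`, and `p` becomes available for `y₁`. -/
theorem IsAcyclicDecomposition.exists_extendable_of_reachable (hC : H.IsAcyclicDecomposition C)
    (hfree : ∀ v, 2 ≤ #(freeColors C v)) (h₁₂ : y₁ ≠ y₂) (h₁₃ : y₁ ≠ y₃) (h₂₃ : y₂ ≠ y₃)
    (hc₁ : 3 ≤ #(freeColors C y₁)) (hc₂ : 3 ≤ #(freeColors C y₂)) (hc₃ : 3 ≤ #(freeColors C y₃))
    (hcompl : ∀ a, IsFree C y₁ a ↔ ¬IsFree C y₂ a) (hcompl' : ∀ a, IsFree C y₃ a ↔ ¬IsFree C y₂ a)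
    {p q s : Fin 6} (hpq : p ≠ q) (hps : p ≠ s) (hqs : q ≠ s)
    (hp₁ : IsFree C y₁ p) (hq₁ : IsFree C y₁ q) (hs₁ : IsFree C y₁ s)
    (hpt : ∀ α, IsFree C y₂ α → ∃ t w, (C p).Adj y₂ t ∧ (C α).Adj t w)
    (hqt : ∀ α, IsFree C y₂ α → ∃ t w, (C q).Adj y₂ t ∧ (C α).Adj t w)
    {α : Fin 6} (hα : IsFree C y₂ α) (hreach_s : (C s ⊔ C α).Reachable y₁ y₂) :
    ∃ C' : Fin 6 → SimpleGraph V, H.IsAcyclicDecomposition C' ∧ Extendable C' y₁ y₂ y₃ := by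
  have hne : ∀ a, IsFree C y₁ a → a ≠ α := fun a ha h ↦ (hcompl a).1 ha (h ▸ hα)
  have to₃ : ∀ a, IsFree C y₁ a → IsFree C y₃ a := fun a ha ↦ (hcompl' a).2 ((hcompl a).1 ha)
  -- The `s`-`α` path starting at `y₂` ends at `y₁`, so it avoids `y₃`.
  have hs₃ : ¬(C s ⊔ C α).Reachable y₂ y₃ := fun h ↦
    h₁₃ (eq_of_reachable_of_leaves (hC.eq_of_adj s) (hC.eq_of_adj α) (.inr hα) (.inl hs₁)
      (.inl (to₃ s hs₁)) h₁₂.symm h₂₃ hreach_s.symm h)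
  by_cases hp : (C p ⊔ C α).Reachable y₁ y₂
  · obtain ⟨C', hC', hCC', hfr, hreach⟩ := hC.exists_exchange hfree hc₂ hpq ((hcompl p).1 hp₁)
      ((hcompl q).1 hq₁) hpt hqt
    have f₁ := hfr y₁ hc₁
    have f₂ := hfr y₂ hc₂
    have f₃ := hfr y₃ hc₃
    refine ⟨C', hC', p, α, s, hne p hp₁, hps, (hne s hs₁).symm, (f₁ p).2 hp₁, (f₂ α).2 hα,
      (f₃ s).2 (to₃ s hs₁), hreach y₁ α h₁₂ hc₁ hp₁ hα hp,
      not_reachable_of_isFree h₁₃ (.inl ⟨(f₁ p).2 hp₁, (f₁ s).2 hs₁⟩), ?_⟩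
    rwa [hCC' α (hne p hp₁).symm (hne q hq₁).symm, hCC' s hps.symm hqs.symm, sup_comm]
  · refine ⟨C, hC, p, α, s, hne p hp₁, hps, (hne s hs₁).symm, hp₁, hα, to₃ s hs₁, hp,
      not_reachable_of_isFree h₁₃ (.inl ⟨hp₁, hs₁⟩), ?_⟩
    rwa [sup_comm]

/-- The lists of `y₁` and `y₃` agree and are complementary to the list of `y₂`. -/
theorem IsAcyclicDecomposition.exists_extendable_of_eq (hC : H.IsAcyclicDecomposition C)
    (hfree : ∀ v, 2 ≤ #(freeColors C v)) (h₁₂ : y₁ ≠ y₂) (h₁₃ : y₁ ≠ y₃) (h₂₃ : y₂ ≠ y₃)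
    (hc₁ : 3 ≤ #(freeColors C y₁)) (hc₂ : 3 ≤ #(freeColors C y₂)) (hc₃ : 3 ≤ #(freeColors C y₃))
    (hcompl : ∀ a, IsFree C y₁ a ↔ ¬IsFree C y₂ a)
    (hcompl' : ∀ a, IsFree C y₃ a ↔ ¬IsFree C y₂ a) :
    ∃ C' : Fin 6 → SimpleGraph V, H.IsAcyclicDecomposition C' ∧ Extendable C' y₁ y₂ y₃ := by
  by_contra! hcon
  have to₃ : ∀ a, IsFree C y₁ a → IsFree C y₃ a := fun a ha ↦ (hcompl' a).2 ((hcompl a).1 ha)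
  -- The colors `i`, `α`, `j` for `y₁`, `y₂`, `y₃` must fail, and `y₁`, `y₃` are not in conflict.
  have stuck : ∀ i j α, i ≠ j → IsFree C y₁ i → IsFree C y₁ j → IsFree C y₂ α →
      (C i ⊔ C α).Reachable y₁ y₂ ∨ (C j ⊔ C α).Reachable y₃ y₂ := by
    intro i j α hij hi hj hα
    by_contra! h
    refine hcon C hC ⟨i, α, j, fun h ↦ (hcompl i).1 hi (h ▸ hα), hij,
      fun h ↦ (hcompl j).1 hj (h ▸ hα), hi, hα, to₃ j hj, h.1,
      not_reachable_of_isFree h₁₃ (.inl ⟨hi, hj⟩), ?_⟩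
    rw [sup_comm, reachable_comm]
    exact h.2
  have notboth : ∀ i α, IsFree C y₁ i → IsFree C y₂ α → (C i ⊔ C α).Reachable y₁ y₂ →
      ¬(C i ⊔ C α).Reachable y₃ y₂ := fun i α hi hα h h' ↦
    h₁₃ (eq_of_reachable_of_leaves (hC.eq_of_adj i) (hC.eq_of_adj α) (.inr hα) (.inl hi)
      (.inl (to₃ i hi)) h₁₂.symm h₂₃ h.symm h'.symm)
  have one : ∀ i j α, i ≠ j → IsFree C y₁ i → IsFree C y₁ j → IsFree C y₂ α →
      (C i ⊔ C α).Reachable y₁ y₂ ∨ (C i ⊔ C α).Reachable y₃ y₂ := by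
    intro i j α hij hi hj hα
    have h₁ := stuck i j α hij hi hj hα
    have h₂ := stuck j i α hij.symm hj hi hα
    have h₃ := notboth j α hj hα
    tauto
  have full : ∀ i j, i ≠ j → IsFree C y₁ i → IsFree C y₁ j → ∀ α, IsFree C y₂ α →
      ∃ t w, (C i).Adj y₂ t ∧ (C α).Adj t w := by
    intro i j hij hi hj α hα
    rcases one i j α hij hi hj hα with h | h
    · exact hC.exists_adj_adj_of_reachable h₁₂ hi hα h
    · exact hC.exists_adj_adj_of_reachable h₂₃.symm (to₃ i hi) hα h
  obtain ⟨p, q, s, hp, hq, hs, hpq, hps, hqs⟩ := two_lt_card_iff.1 hc₁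
  obtain ⟨α, hα⟩ := card_pos.1 (by omega : 0 < #(freeColors C y₂))
  rw [mem_freeColors] at hp hq hs hα
  have hpt := full p q hpq hp hq
  have hqt := full q p hpq.symm hq hp
  rcases one s p α hps.symm hs hp hα with h | h
  · obtain ⟨C', hC', hE⟩ := hC.exists_extendable_of_reachable hfree h₁₂ h₁₃ h₂₃ hc₁ hc₂ hc₃
      hcompl hcompl' hpq hps hqs hp hq hs hpt hqt hα h
    exact hcon C' hC' hE
  · obtain ⟨C', hC', hE⟩ := hC.exists_extendable_of_reachable hfree h₂₃.symm h₁₃.symm h₁₂.symm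
      hc₃ hc₂ hc₁ hcompl' hcompl hpq hps hqs (to₃ p hp) (to₃ q hq) (to₃ s hs) hpt hqt hα h
    exact hcon C' hC' hE.swap₁₂.swap₂₃.swap₁₂

theorem IsAcyclicDecomposition.exists_extendable_of_disjoint (hC : H.IsAcyclicDecomposition C)
    (hfree : ∀ v, 2 ≤ #(freeColors C v)) (h₁₂ : y₁ ≠ y₂) (h₁₃ : y₁ ≠ y₃) (h₂₃ : y₂ ≠ y₃)
    (hc₁ : 3 ≤ #(freeColors C y₁)) (hc₂ : 3 ≤ #(freeColors C y₂)) (hc₃ : 3 ≤ #(freeColors C y₃))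
    (hd : Disjoint (freeColors C y₁) (freeColors C y₂)) :
    ∃ C' : Fin 6 → SimpleGraph V, H.IsAcyclicDecomposition C' ∧ Extendable C' y₁ y₂ y₃ := by
  have hcompl := isFree_iff_not_isFree hc₁ hc₂ hd
  have hcompl' : ∀ a, IsFree C y₂ a ↔ ¬IsFree C y₁ a := fun a ↦ by rw [hcompl, not_not]
  by_cases hd₂ : Disjoint (freeColors C y₃) (freeColors C y₂)
  · exact hC.exists_extendable_of_eq hfree h₁₂ h₁₃ h₂₃ hc₁ hc₂ hc₃ hcompl
      (isFree_iff_not_isFree hc₃ hc₂ hd₂)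
  by_cases hd₁ : Disjoint (freeColors C y₃) (freeColors C y₁)
  · obtain ⟨C', hC', hE⟩ := hC.exists_extendable_of_eq hfree h₁₂.symm h₂₃ h₁₃ hc₂ hc₁ hc₃ hcompl'
      (isFree_iff_not_isFree hc₃ hc₁ hd₁)
    exact ⟨C', hC', hE.swap₁₂⟩
  obtain ⟨a, ha₃, ha₁⟩ := not_disjoint_iff.1 hd₁
  obtain ⟨b, hb₃, hb₂⟩ := not_disjoint_iff.1 hd₂
  obtain ⟨c, hc, hcab⟩ : ∃ c ∈ freeColors C y₃, c ∉ ({a, b} : Finset (Fin 6)) :=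
    exists_mem_notMem_of_card_lt_card (lt_of_le_of_lt card_le_two hc₃)
  simp only [mem_insert, mem_singleton, not_or, mem_freeColors] at *
  by_cases hc₁' : IsFree C y₁ c
  · exact hC.exists_extendable_of_mixed hfree h₁₂ h₁₃ h₂₃ hc₁ hc₂ hc₃ hcompl (Ne.symm hcab.1)
      ha₁ hc₁' ha₃ hc hb₂ hb₃
  · obtain ⟨C', hC', hE⟩ := hC.exists_extendable_of_mixed hfree h₁₂.symm h₂₃ h₁₃ hc₂ hc₁ hc₃
      hcompl' (Ne.symm hcab.2) hb₂ ((hcompl' c).2 hc₁') hb₃ hc ha₁ ha₃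
    exact ⟨C', hC', hE.swap₁₂⟩

theorem IsAcyclicDecomposition.exists_extendable (hC : H.IsAcyclicDecomposition C)
    (hfree : ∀ v, 2 ≤ #(freeColors C v)) (h₁₂ : y₁ ≠ y₂) (h₁₃ : y₁ ≠ y₃) (h₂₃ : y₂ ≠ y₃)
    (hc₁ : 3 ≤ #(freeColors C y₁)) (hc₂ : 3 ≤ #(freeColors C y₂))
    (hc₃ : 3 ≤ #(freeColors C y₃)) :
    ∃ C' : Fin 6 → SimpleGraph V, H.IsAcyclicDecomposition C' ∧ Extendable C' y₁ y₂ y₃ := by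
  by_cases hd₁₂ : Disjoint (freeColors C y₁) (freeColors C y₂)
  · exact hC.exists_extendable_of_disjoint hfree h₁₂ h₁₃ h₂₃ hc₁ hc₂ hc₃ hd₁₂
  by_cases hd₁₃ : Disjoint (freeColors C y₁) (freeColors C y₃)
  · obtain ⟨C', hC', hE⟩ := hC.exists_extendable_of_disjoint hfree h₁₃ h₁₂ h₂₃.symm hc₁ hc₃ hc₂ hd₁₃
    exact ⟨C', hC', hE.swap₂₃⟩
  by_cases hd₂₃ : Disjoint (freeColors C y₂) (freeColors C y₃)
  · obtain ⟨C', hC', hE⟩ := hC.exists_extendable_of_disjoint hfree h₂₃ h₁₂.symm h₁₃.symm hc₂ hc₃ hc₁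
      hd₂₃
    exact ⟨C', hC', hE.swap₂₃.swap₁₂⟩
  exact ⟨C, hC, extendable_of_pairwise_inter h₁₂ h₁₃ h₂₃ hc₁ hc₂ hc₃ hd₁₂ hd₁₃ hd₂₃⟩

end Recolor

/-! ### Induction on the vertex set -/

section Induction

/-- The edges of `G` with both ends in `S`, as a graph on all of `V`. -/
def restrictTo (G : SimpleGraph V) (S : Finset V) : SimpleGraph V where
  Adj u v := G.Adj u v ∧ u ∈ S ∧ v ∈ S
  symm := ⟨fun _ _ h ↦ ⟨h.1.symm, h.2.2, h.2.1⟩⟩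
  loopless := ⟨fun _ h ↦ h.1.ne rfl⟩

theorem restrictTo_adj {G : SimpleGraph V} {S : Finset V} {u v : V} :
    (G.restrictTo S).Adj u v ↔ G.Adj u v ∧ u ∈ S ∧ v ∈ S := Iff.rfl

theorem IsAcyclicDecomposition.exists_addVertex [DecidableEq V] {H H' : SimpleGraph V}
    {C : Fin 6 → SimpleGraph V} (hC : H.IsAcyclicDecomposition C)
    (hfree : ∀ v, 2 ≤ #(freeColors C v)) {x : V} (hx : ∀ w, ¬H.Adj x w) {N : Finset V}
    (hxN : x ∉ N) (hN : #N ≤ 3) (hNfree : ∀ y ∈ N, 3 ≤ #(freeColors C y))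
    (hH' : ∀ u v, H'.Adj u v ↔ H.Adj u v ∨ (u = x ∧ v ∈ N) ∨ (v = x ∧ u ∈ N)) :
    ∃ C' : Fin 6 → SimpleGraph V, H'.IsAcyclicDecomposition C' := by
  rcases Nat.lt_or_ge (#N) 2 with hN2 | hN2
  · have hsub : ∀ y ∈ N, ∀ z ∈ N, y = z := card_le_one.1 (by omega)
    have hex : ∀ y : V, ∃ a, y ∈ N → IsFree C y a := by
      intro y
      by_cases hy : y ∈ N
      · obtain ⟨a, ha⟩ := card_pos.1 (by have := hNfree y hy; omega : 0 < #(freeColors C y))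
        exact ⟨a, fun _ ↦ mem_freeColors.1 ha⟩
      · exact ⟨0, fun h ↦ absurd h hy⟩
    choose f hf using hex
    exact ⟨_, hC.addVertex hx (N := (N : Set V)) (by simpa using hxN) (f := f) (by simpa using hH')
      (fun y hy z hz _ ↦ hsub y hy z hz) (fun y hy ↦ hf y hy)
      fun y hy z hz hyz ↦ absurd (hsub y hy z hz) hyz⟩
  obtain ⟨y₁, y₂, y₃, h₁₂, h₁₃, h₂₃, hc₁, hc₂, hc₃, hsub⟩ : ∃ y₁ y₂ y₃, y₁ ≠ y₂ ∧ y₁ ≠ y₃ ∧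
      y₂ ≠ y₃ ∧ 3 ≤ #(freeColors C y₁) ∧ 3 ≤ #(freeColors C y₂) ∧ 3 ≤ #(freeColors C y₃) ∧
      ∀ y ∈ N, y = y₁ ∨ y = y₂ ∨ y = y₃ := by
    rcases hN2.eq_or_lt with h2 | h3
    · -- The isolated vertex `x` serves as a third, unconstrained, neighbor.
      obtain ⟨y₁, y₂, h₁₂, rfl⟩ := card_eq_two.1 h2.symm
      refine ⟨y₁, y₂, x, h₁₂, by grind, by grind, hNfree _ (by simp), hNfree _ (by simp), ?_,
        by grind⟩
      have : freeColors C x = univ := by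
        ext a
        simp only [mem_freeColors, mem_univ, iff_true]
        exact fun w h ↦ hx w ((hC.adj_iff _ _).2 ⟨a, h⟩)
      rw [this, card_univ, Fintype.card_fin]
      norm_num
    · obtain ⟨y₁, y₂, y₃, h₁₂, h₁₃, h₂₃, rfl⟩ := card_eq_three.1 (by omega : #N = 3)
      exact ⟨y₁, y₂, y₃, h₁₂, h₁₃, h₂₃, hNfree _ (by simp), hNfree _ (by simp),
        hNfree _ (by simp), by simp⟩
  obtain ⟨C', hC', a₁, a₂, a₃, n₁₂, n₁₃, n₂₃, f₁, f₂, f₃, r₁₂, r₁₃, r₂₃⟩ :=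
    hC.exists_extendable hfree h₁₂ h₁₃ h₂₃ hc₁ hc₂ hc₃
  let f : V → Fin 6 := fun v ↦ if v = y₁ then a₁ else if v = y₂ then a₂ else a₃
  have e₁ : f y₁ = a₁ := by simp [f]
  have e₂ : f y₂ = a₂ := by simp [f, h₁₂.symm]
  have e₃ : f y₃ = a₃ := by simp [f, h₁₃.symm, h₂₃.symm]
  have r₂₁ := r₁₂
  have r₃₁ := r₁₃
  have r₃₂ := r₂₃
  rw [sup_comm, reachable_comm] at r₂₁ r₃₁ r₃₂
  refine ⟨_, hC'.addVertex hx (N := (N : Set V)) (by simpa using hxN) (f := f) (by simpa using hH')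
    ?_ ?_ ?_⟩
  · intro y hy z hz h
    have := hsub y hy
    have := hsub z hz
    grind
  · intro y hy
    rcases hsub y hy with rfl | rfl | rfl
    · rwa [e₁]
    · rwa [e₂]
    · rwa [e₃]
  · intro y hy z hz hyz
    rcases hsub y hy with rfl | rfl | rfl <;> rcases hsub z hz with rfl | rfl | rfl <;>
      simp only [e₁, e₂, e₃] <;> first | assumption | exact absurd rfl hyz

theorem exists_isAcyclicDecomposition_restrictTo [Fintype V] [DecidableEq V] (G : SimpleGraph V)
    [DecidableRel G.Adj] (hdeg : G.maxDegree ≤ 4)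
    (hdegen : ∀ S : Finset V, S.Nonempty → ∃ x ∈ S, #{v ∈ S | G.Adj x v} ≤ 3) (S : Finset V) :
    ∃ C : Fin 6 → SimpleGraph V, (G.restrictTo S).IsAcyclicDecomposition C := by
  induction S using Finset.strongInduction with
  | H S ih =>
  rcases S.eq_empty_or_nonempty with rfl | hS
  · refine ⟨fun _ ↦ ⊥, ?_, ?_, ?_, ?_⟩ <;> simp [restrictTo_adj]
  obtain ⟨x, hxS, hx⟩ := hdegen S hS
  obtain ⟨C, hC⟩ := ih _ (erase_ssubset hxS)
  have hdeg' : ∀ v, #(G.neighborFinset v) ≤ 4 := fun v ↦ (G.degree_le_maxDegree v).trans hdeg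
  have hcard : ∀ v (s : Finset V), (∀ w, (G.restrictTo (S.erase x)).Adj v w → w ∈ s) →
      6 ≤ #s + #(freeColors C v) := by
    classical
    intro v s hs
    have := hC.card_le_card_add_card_free v s hs
    simpa [freeColors] using this
  refine hC.exists_addVertex (x := x) (N := {v ∈ S | G.Adj x v}) ?_ ?_ ?_ hx ?_ ?_
  · intro v
    have := hcard v (G.neighborFinset v) fun w hw ↦ by simpa using hw.1
    have := hdeg' v
    omega
  · intro w hw
    simp [restrictTo_adj] at hw
  · simp
  · intro y hy
    have hyx : G.Adj y x := (mem_filter.1 hy).2.symm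
    have := hcard y ((G.neighborFinset y).erase x) fun w hw ↦ by
      simp only [restrictTo_adj, mem_erase] at hw
      simp [hw]
    rw [card_erase_of_mem (by simpa using hyx)] at this
    have := hdeg' y
    omega
  · intro u v
    have := G.adj_comm u v
    have : ¬G.Adj x x := G.irrefl
    simp only [restrictTo_adj, mem_erase, mem_filter]
    grind

theorem Connected.exists_card_filter_adj_le_three [Fintype V] [DecidableEq V] {G : SimpleGraph V}
    [DecidableRel G.Adj] (hconn : G.Connected)
    (hedges : #G.edgeFinset ≤ 2 * Fintype.card V - 1) (hdeg : G.maxDegree ≤ 4)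
    (S : Finset V) (hS : S.Nonempty) : ∃ x ∈ S, #{v ∈ S | G.Adj x v} ≤ 3 := by
  by_cases hu : S = univ
  · subst hu
    by_contra! h
    have h4 : ∀ v ∈ (univ : Finset V), 4 ≤ G.degree v := by
      intro v hv
      rw [← card_neighborFinset_eq_degree, neighborFinset_eq_filter]
      exact h v hv
    have h1 := card_nsmul_le_sum univ _ 4 h4
    rw [sum_degrees_eq_twice_card_edges, card_univ, smul_eq_mul] at h1
    have : 0 < Fintype.card V := Fintype.card_pos_iff.2 hconn.nonempty
    omega
  · obtain ⟨u, hu'⟩ := hS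
    obtain ⟨w, hw⟩ : ∃ w, w ∉ S := by
      by_contra! h
      exact hu (eq_univ_iff_forall.2 h)
    have : ∃ x ∈ S, ∃ z, z ∉ S ∧ G.Adj x z := by
      by_contra! h
      exact hw (mem_of_reachable_of_closed (S := (S : Set V)) (hconn u w) hu' fun x hx z hz ↦
        by_contra fun hzS ↦ h x hx z hzS hz)
    obtain ⟨x, hx, z, hz, hxz⟩ := this
    refine ⟨x, hx, ?_⟩
    have hss : ({v ∈ S | G.Adj x v} : Finset V) ⊂ G.neighborFinset x := by
      refine Finset.ssubset_iff_subset_ne.2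
        ⟨fun v hv ↦ by simpa using (mem_filter.1 hv).2, fun h ↦ hz ?_⟩
      have : z ∈ G.neighborFinset x := by simpa using hxz
      rw [← h] at this
      exact (mem_filter.1 this).1
    have := card_lt_card hss
    have := (G.degree_le_maxDegree x).trans hdeg
    rw [← card_neighborFinset_eq_degree] at this
    omega

end Induction

end SimpleGraph

theorem theorem1 {V : Type*} [Fintype V] (G : SimpleGraph V) [DecidableRel G.Adj]
    (hconn : G.Connected)
    (hedges : G.edgeFinset.card ≤ 2 * Fintype.card V - 1)
    (hdeg : G.maxDegree ≤ 4) :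
    G.AcyclicEdgeColorable 6 ∧ G.acyclicChromaticIndex ≤ 6 ∧
      (G.maxDegree = 4 → G.acyclicChromaticIndex ≤ (G.maxDegree : ℕ∞) + 2) := by
  classical
  have hcol : G.AcyclicEdgeColorable 6 := by
    obtain ⟨C, hC⟩ := G.exists_isAcyclicDecomposition_restrictTo hdeg
      (hconn.exists_card_filter_adj_le_three (by convert hedges) hdeg) Finset.univ
    have hG : G.restrictTo Finset.univ = G := by
      ext u v
      simp [SimpleGraph.restrictTo_adj]
    rw [hG] at hC
    exact hC.exists_edgeLabeling
  have hindex : G.acyclicChromaticIndex ≤ 6 := iInf₂_le 6 hcol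
  refine ⟨hcol, hindex, fun h ↦ hindex.trans ?_⟩
  rw [h]
  norm_num
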